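/- Let $\gamma>0$ and $\alpha=2/\gamma^2$. Let $\mathcal H_\gamma$ be the space of entire functions $f$ on $\mathbb C$ with $$\|f\|_{\mathcal H_\gamma}^2=\frac{2}{\pi\gamma^2}\int_{\mathbb C}|f(z)|^2\exp\Big(\frac{(z-\overline z)^2}{\gamma^2}\Big)\,dA(z)<\infty ,$$ with the corresponding inner product. Put $e_n^\gamma(z)=\sqrt{\frac{2^n}{\gamma^{2n}n!}}\,z^n e^{-z^2/\gamma^2}$, let $\psi_n^\alpha(x)=\big(\frac{\alpha}{\pi}\big)^{1/4}\frac{1}{\sqrt{2^n n!}}H_n(\sqrt\alpha\,x)\,e^{-\alpha x^2/2}$ be the normalized weighted Hermite functions ($H_n$ being the physicists' Hermite polynomials), and $$\mathcal A_{RBF}^\gamma(z,x)=\sum_{n=0}^\infty e_n^\gamma(z)\,\psi_n^\alpha(x),\qquad z\in\mathbb C,\ x\in\mathbb R .$$ This series converges for all $z,x$, and $$\mathcal A_{RBF}^\gamma(z,x)=\Big(\frac{2}{\pi\gamma^2}\Big)^{1/4}\exp\Big(-\frac{(x-\sqrt2\,z)^2}{\gamma^2}\Big).$$ The function $\Phi(z)=\mathcal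 A_{RBF}^\gamma(z,\cdot)$ belongs to $L^2(\mathbb R)$ for every $z$. For $\psi\in L^2(\mathbb R)$ and $z\in\mathbb C$ the RBF Segal--Bargmann transform $$\mathfrak B_{RBF}^\gamma[\psi](z)=\int_{\mathbb R}\mathcal A_{RBF}^\gamma(z,x)\psi(x)\,dx=\Big(\frac{2}{\pi\gamma^2}\Big)^{1/4}\int_{\mathbb R}\exp\Big(-\frac{(x-\sqrt2\,z)^2}{\gamma^2}\Big)\psi(x)\,dx$$ is given by an absolutely convergent integral and equals $\langle\Phi(\overline z),\psi\rangle_{L^2(\mathbb R)}$ (inner product conjugate-linear in the first variable). The map $\psi\mapsto\mathfrak B_{RBF}^\gamma[\psi]$ is a (linear, surjective) isometric isomorphism of $L^2(\mathbb R)$ onto $\mathcal H_\gamma$. Moreover, for all $\psi\in L^2(\mathbb R)$ and $z\in\mathbb C$, $$\mathfrak B_{RBF}^\gamma[\psi](z)=e^{-z^2/\gamma^2}\,B_{\alpha}[\psi](z),\qquad B_\alpha[\psi](z)=\Big(\frac{\alpha}{\pi}\Big)^{1/4}\int_{\mathbb R}\exp\Big(-\frac{\alpha}{2}(z^2+x^2)+\sqrt2\,\alpha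 zx\Big)\psi(x)\,dx ,$$ where $B_\alpha$ is the classical Segal--Bargmann transform. -/

import Mathlib

open MeasureTheory Complex
open scoped ComplexConjugate

noncomputable section

/-- The weight of the RBF space: `exp ((z - conj z)² / γ²) = exp (-4 (Im z)² / γ²)`. -/
def rbfWeight (γ : ℝ) (z : ℂ) : ℝ := Real.exp (-(4 * z.im ^ 2) / γ ^ 2)

theorem rbfWeight_eq (γ : ℝ) (z : ℂ) :
    (rbfWeight γ z : ℂ) = Complex.exp ((z - conj z) ^ 2 / (γ : ℂ) ^ 2) := by
  rw [rbfWeight, Complex.ofReal_exp, Complex.sub_conj]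
  congr 1
  push_cast
  rw [mul_pow, mul_pow, Complex.I_sq]
  ring

theorem rbfWeight_pos (γ : ℝ) (z : ℂ) : 0 < rbfWeight γ z := Real.exp_pos _

theorem continuous_rbfWeight (γ : ℝ) : Continuous (rbfWeight γ) := by
  unfold rbfWeight
  fun_prop

/-- If `f`, `g` are entire and square integrable for the weight, then `conj f * g` is integrable
for the weight. -/
theorem rbf_integrable_conj_mul {γ : ℝ} {f g : ℂ → ℂ}
    (hf : Differentiable ℂ f) (hg : Differentiable ℂ g)
    (hf2 : Integrable (fun z => ‖f z‖ ^ 2 * rbfWeight γ z))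
    (hg2 : Integrable (fun z => ‖g z‖ ^ 2 * rbfWeight γ z)) :
    Integrable (fun z => conj (f z) * g z * (rbfWeight γ z : ℂ)) := by
  have hfc := hf.continuous
  have hgc := hg.continuous
  have hw := continuous_rbfWeight γ
  refine (hf2.add hg2).mono' (Continuous.aestronglyMeasurable (by fun_prop)) ?_
  refine Filter.Eventually.of_forall fun z => ?_
  have h0 := rbfWeight_pos γ z
  simp only [norm_mul, RCLike.norm_conj, Complex.norm_real, Real.norm_eq_abs, abs_of_pos h0,
    Pi.add_apply]
  rw [← add_mul]
  refine mul_le_mul_of_nonneg_right ?_ h0.le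
  nlinarith [sq_nonneg (‖f z‖ - ‖g z‖), sq_nonneg ‖f z‖, sq_nonneg ‖g z‖]

/-- The vector space underlying the RBF space: entire functions `f` with
`∫ |f(z)|² exp ((z - conj z)² / γ²) dA(z) < ∞`. -/
def rbfSubmodule (γ : ℝ) : Submodule ℂ (ℂ → ℂ) where
  carrier := {f | Differentiable ℂ f ∧ Integrable (fun z => ‖f z‖ ^ 2 * rbfWeight γ z)}
  zero_mem' := ⟨differentiable_const 0, by simp⟩
  add_mem' := by
    rintro f g ⟨hf, hf2⟩ ⟨hg, hg2⟩
    refine ⟨hf.add hg, ?_⟩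
    have hfc := hf.continuous
    have hgc := hg.continuous
    have hw := continuous_rbfWeight γ
    refine ((hf2.add hg2).const_mul 2).mono'
      (Continuous.aestronglyMeasurable (by fun_prop)) ?_
    refine Filter.Eventually.of_forall fun z => ?_
    have h0 := rbfWeight_pos γ z
    have h1 : ‖f z + g z‖ ≤ ‖f z‖ + ‖g z‖ := norm_add_le _ _
    have h2 : ‖f z + g z‖ ^ 2 ≤ 2 * (‖f z‖ ^ 2 + ‖g z‖ ^ 2) := by
      nlinarith [sq_nonneg (‖f z‖ - ‖g z‖), norm_nonneg (f z + g z), norm_nonneg (f z),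
        norm_nonneg (g z)]
    simp only [Pi.add_apply, norm_mul, norm_pow, Real.norm_eq_abs, abs_of_pos h0,
      abs_norm]
    nlinarith [mul_le_mul_of_nonneg_right h2 h0.le]
  smul_mem' := by
    rintro c f ⟨hf, hf2⟩
    refine ⟨hf.const_smul c, ?_⟩
    refine (hf2.const_mul (‖c‖ ^ 2)).congr (Filter.Eventually.of_forall fun z => ?_)
    simp only [Pi.smul_apply, smul_eq_mul, norm_mul]
    ring

/-- The RBF space `H_γ`, for `γ > 0`. Its norm is
`‖f‖² = 2 / (π γ²) * ∫ |f(z)|² exp ((z - conj z)² / γ²) dA(z)`. -/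
def RBFSpace (γ : ℝ) (_hγ : 0 < γ) : Type := rbfSubmodule γ

namespace RBFSpace

variable {γ : ℝ} {hγ : 0 < γ}

instance : AddCommGroup (RBFSpace γ hγ) := inferInstanceAs (AddCommGroup (rbfSubmodule γ))

instance : Module ℂ (RBFSpace γ hγ) := inferInstanceAs (Module ℂ (rbfSubmodule γ))

instance : CoeFun (RBFSpace γ hγ) (fun _ => ℂ → ℂ) := ⟨fun f => f.1⟩

theorem ext_fun {f g : RBFSpace γ hγ} (h : ∀ z, f z = g z) : f = g := Subtype.ext (funext h)

theorem differentiable (f : RBFSpace γ hγ) : Differentiable ℂ (f : ℂ → ℂ) := f.2.1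

theorem integrable (f : RBFSpace γ hγ) :
    Integrable (fun z => ‖f z‖ ^ 2 * rbfWeight γ z) := f.2.2

theorem add_apply (f g : RBFSpace γ hγ) (z : ℂ) : (f + g) z = f z + g z := rfl

theorem smul_apply (c : ℂ) (f : RBFSpace γ hγ) (z : ℂ) : (c • f) z = c * f z := rfl

instance : Inner ℂ (RBFSpace γ hγ) :=
  ⟨fun f g => ((2 / (Real.pi * γ ^ 2) : ℝ) : ℂ) *
    ∫ z, conj (f z) * g z * (rbfWeight γ z : ℂ)⟩

theorem inner_def (f g : RBFSpace γ hγ) :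
    inner ℂ f g = ((2 / (Real.pi * γ ^ 2) : ℝ) : ℂ) *
      ∫ z, conj (f z) * g z * (rbfWeight γ z : ℂ) := rfl

theorem inner_self_eq (f : RBFSpace γ hγ) :
    inner ℂ f f =
      ((2 / (Real.pi * γ ^ 2) * ∫ z, ‖f z‖ ^ 2 * rbfWeight γ z : ℝ) : ℂ) := by
  rw [inner_def, Complex.ofReal_mul, ← integral_complex_ofReal]
  congr 2
  funext z
  rw [Complex.conj_mul']
  push_cast
  rfl

@[reducible] def innerCore : InnerProductSpace.Core ℂ (RBFSpace γ hγ) where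
  conj_inner_symm f g := by
    rw [inner_def, inner_def, map_mul, Complex.conj_ofReal, ← integral_conj]
    congr 2
    funext z
    simp only [map_mul, Complex.conj_conj, Complex.conj_ofReal]
    ring
  re_inner_nonneg f := by
    rw [inner_self_eq]
    simp only [RCLike.re_to_complex, Complex.ofReal_re]
    exact mul_nonneg (by positivity)
      (integral_nonneg fun z => mul_nonneg (sq_nonneg _) (rbfWeight_pos γ z).le)
  add_left f g h := by
    simp only [inner_def]
    rw [← mul_add, ← integral_add
      (rbf_integrable_conj_mul f.differentiable h.differentiable f.integrable h.integrable)
      (rbf_integrable_conj_mul g.differentiable h.differentiable g.integrable h.integrable)]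
    congr 2
    funext z
    rw [add_apply, map_add]
    ring
  smul_left f g c := by
    simp only [inner_def]
    rw [mul_left_comm, ← integral_const_mul (conj c)]
    congr 2
    funext z
    rw [smul_apply, map_mul]
    ring
  definite f hf := by
    rw [inner_self_eq, Complex.ofReal_eq_zero] at hf
    have hc : (2 / (Real.pi * γ ^ 2)) ≠ 0 := by positivity
    have hi := (mul_eq_zero.mp hf).resolve_left hc
    rw [integral_eq_zero_iff_of_nonneg
      (fun z => mul_nonneg (sq_nonneg _) (rbfWeight_pos γ z).le) f.integrable] at hi
    have hfc := f.differentiable.continuous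
    have hw := continuous_rbfWeight γ
    have h0 := (Continuous.ae_eq_iff_eq volume ((hfc.norm.pow 2).mul hw) continuous_zero).mp hi
    refine ext_fun fun z => ?_
    have hz := congrFun h0 z
    simp only [Pi.zero_apply] at hz
    have := (mul_eq_zero.mp hz).resolve_right (rbfWeight_pos γ z).ne'
    exact norm_eq_zero.mp (pow_eq_zero_iff two_ne_zero |>.mp this)

instance : NormedAddCommGroup (RBFSpace γ hγ) :=
  (innerCore (γ := γ) (hγ := hγ)).toNormedAddCommGroup

instance : InnerProductSpace ℂ (RBFSpace γ hγ) := InnerProductSpace.ofCore innerCore.toCore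

theorem norm_sq_eq (f : RBFSpace γ hγ) :
    ‖f‖ ^ 2 = 2 / (Real.pi * γ ^ 2) * ∫ z, ‖f z‖ ^ 2 * rbfWeight γ z := by
  have h := inner_self_eq_norm_sq_to_K (𝕜 := ℂ) f
  rw [show inner ℂ f f = _ from inner_self_eq f] at h
  exact Complex.ofReal_injective ((Complex.ofReal_pow _ _).trans h.symm)

end RBFSpace

/-- The functions `e_n^γ(z) = √(2ⁿ / (γ²ⁿ n!)) zⁿ exp (-z² / γ²)` of the RBF space. -/
def rbfBasis (γ : ℝ) (n : ℕ) (z : ℂ) : ℂ :=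
  (Real.sqrt (2 ^ n / (γ ^ (2 * n) * (n.factorial : ℝ))) : ℂ) * z ^ n *
    Complex.exp (-z ^ 2 / (γ : ℂ) ^ 2)

/-- The `n`-th normalized weighted Hermite function with parameter `α`,
`(α / π)^(1/4) (2ⁿ n!)^(-1/2) H_n(√α x) exp (-α x² / 2)`, where `H_n` is the physicists' Hermite
polynomial. With the probabilists' polynomial `He_n = Polynomial.hermite n` one has
`H_n(t) = 2^(n/2) He_n(√2 t)`. -/
def hermiteFun (α : ℝ) (n : ℕ) (x : ℝ) : ℝ :=
  (α / Real.pi) ^ (1 / 4 : ℝ) / Real.sqrt (n.factorial : ℝ) *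
    Polynomial.aeval (Real.sqrt (2 * α) * x) (Polynomial.hermite n) *
    Real.exp (-α * x ^ 2 / 2)

/-- The RBF Segal-Bargmann kernel, the generating series `∑ e_n^γ(z) ψ_n^α(x)` with
`α = 2 / γ²`. -/
def rbfKernel (γ : ℝ) (z : ℂ) (x : ℝ) : ℂ :=
  ∑' n : ℕ, rbfBasis γ n z * (hermiteFun (2 / γ ^ 2) n x : ℂ)

/-- The RBF Segal-Bargmann transform. -/
def rbfTransform (γ : ℝ) (ψ : ℝ → ℂ) (z : ℂ) : ℂ := ∫ x : ℝ, rbfKernel γ z x * ψ x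

/-- The classical (normalized) Segal-Bargmann kernel of the Fock space with parameter `α`. -/
def bargmannKernel (α : ℝ) (z : ℂ) (x : ℝ) : ℂ :=
  ((α / Real.pi) ^ (1 / 4 : ℝ) : ℝ) *
    Complex.exp (-((α : ℂ) / 2) * (z ^ 2 + (x : ℂ) ^ 2) + (Real.sqrt 2 : ℂ) * α * z * x)

/-- The classical Segal-Bargmann transform `B_α`. -/
def bargmannTransform (α : ℝ) (ψ : ℝ → ℂ) (z : ℂ) : ℂ := ∫ x : ℝ, bargmannKernel α z x * ψ x

end

/-! The kernel is the Hermite generating function `hasSum_hermite` at t = 2x/γ, s = √2 z/γ, times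
two Gaussians that complete the square.

Write z = u + iv. Up to a factor of known modulus, the transform at z is the Fourier transform of ψ
multiplied by a Gaussian window centred at √2 u, at a frequency proportional to v
(`norm_rbfTransform`). The weight cancels the growth in v exactly. Plancherel in v, then Tonelli and
a Gaussian integral in u, give ‖ψ‖² with the right constant (`lintegral_enorm_rbfTransform`).
Holomorphy holds because the transform is a bilateral Laplace transform in disguise.

The range of an isometry of a complete space is complete, so surjectivity follows once only 0 is
orthogonal to it. The range contains nonzero multiples of the functions exp(-(z - conj w)²/γ²)
(`rbfTransform_rbfKernel`), and a function orthogonal to such a multiple vanishes at w: after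
translation by w the inner product is the integral of an entire function against a radial Gaussian,
which the mean value property evaluates (`RBFSpace.apply_eq_zero_of_inner_eq_zero`). -/

/-! ### Hermite generating function and closed form of the kernel. -/

/-- This is the recursion He_{n+1} = X He_n - He_n': the inner function t - s contributes -He_n',
and the exponential contributes the factor t - s. -/
theorem hasDerivAt_aeval_hermite_sub_mul_cexp (n : ℕ) (t s : ℂ) :
    HasDerivAt (fun s : ℂ => Polynomial.aeval (t - s) (Polynomial.hermite n) *
        cexp (t * s - s ^ 2 / 2))
      (Polynomial.aeval (t - s) (Polynomial.hermite (n + 1)) * cexp (t * s - s ^ 2 / 2)) s := by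
  have h1 : HasDerivAt (fun s : ℂ => t - s) (-1) s := by
    simpa using (hasDerivAt_id s).const_sub t
  have h2 := ((Polynomial.hermite n).hasDerivAt_aeval (t - s)).comp s h1
  have h3 : HasDerivAt (fun s : ℂ => t * s - s ^ 2 / 2) (t - s) s := by
    have := ((hasDerivAt_id s).const_mul t).sub (((hasDerivAt_id s).pow 2).div_const 2)
    exact this.congr_deriv (by simp)
  refine (h2.mul h3.cexp).congr_deriv ?_
  rw [Polynomial.hermite_succ]
  simp only [map_sub, map_mul, Polynomial.aeval_X, Function.comp]
  ring

/-- The derivatives of the generating function of the Hermite polynomials. -/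
theorem iteratedDeriv_cexp_hermite (n : ℕ) (t : ℂ) :
    iteratedDeriv n (fun s : ℂ => cexp (t * s - s ^ 2 / 2)) =
      fun s => Polynomial.aeval (t - s) (Polynomial.hermite n) * cexp (t * s - s ^ 2 / 2) := by
  induction n with
  | zero => ext s; simp
  | succ n ih =>
    rw [iteratedDeriv_succ, ih]
    ext s
    exact (hasDerivAt_aeval_hermite_sub_mul_cexp n t s).deriv

/-- The exponential generating function of the Hermite polynomials. -/
theorem hasSum_hermite (t s : ℂ) :
    HasSum (fun n : ℕ => s ^ n / (n.factorial : ℂ) * Polynomial.aeval t (Polynomial.hermite n))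
      (cexp (t * s - s ^ 2 / 2)) := by
  have hd : Differentiable ℂ (fun s : ℂ => cexp (t * s - s ^ 2 / 2)) := by fun_prop
  -- Taylor expansion at s = 0, where the n-th derivative is He_n(t).
  have h := Complex.hasSum_taylorSeries_of_entire hd 0 s
  simp only [iteratedDeriv_cexp_hermite] at h
  refine cast (congrArg (fun f => HasSum f _) (funext fun n => ?_)) h
  simp [div_eq_mul_inv]
  ring

/-- Matches the product of the two normalizing constants with the coefficient sⁿ/n! of the
generating function, where s = √2 z/γ. -/
theorem sqrt_two_pow_div_mul_inv {γ : ℝ} (hγ : 0 < γ) (n : ℕ) :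
    Real.sqrt (2 ^ n / (γ ^ (2 * n) * (n.factorial : ℝ))) / Real.sqrt (n.factorial : ℝ) =
      (Real.sqrt 2 / γ) ^ n / n.factorial := by
  have hf : (0 : ℝ) < n.factorial := by positivity
  rw [← Real.sqrt_div' _ hf.le, Real.sqrt_eq_iff_mul_self_eq_of_pos (by positivity)]
  have : (Real.sqrt 2 / γ) ^ n * (Real.sqrt 2 / γ) ^ n = 2 ^ n / γ ^ (2 * n) := by
    rw [← mul_pow, div_mul_div_comm, Real.mul_self_sqrt (by norm_num), ← sq, div_pow, pow_mul]
  field_simp at this ⊢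
  linear_combination this

theorem hasSum_rbfKernel_exp {γ : ℝ} (hγ : 0 < γ) (z : ℂ) (x : ℝ) :
    HasSum (fun n : ℕ => rbfBasis γ n z * (hermiteFun (2 / γ ^ 2) n x : ℂ))
      ((((2 / (Real.pi * γ ^ 2)) ^ (1 / 4 : ℝ) : ℝ) : ℂ) *
          Complex.exp (-((x : ℂ) - (Real.sqrt 2 : ℂ) * z) ^ 2 / (γ : ℂ) ^ 2)) := by
  have hγ' : (γ : ℂ) ≠ 0 := by exact_mod_cast hγ.ne'
  have h2 : (Real.sqrt 2 : ℂ) ^ 2 = 2 := by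
    rw [← Complex.ofReal_pow, Real.sq_sqrt (by norm_num)]; norm_num
  have hs : Real.sqrt (2 * (2 / γ ^ 2)) = 2 / γ := by
    rw [show 2 * (2 / γ ^ 2) = (2 / γ) ^ 2 by ring, Real.sqrt_sq (by positivity)]
  have h := (hasSum_hermite (((2 / γ * x : ℝ) : ℂ)) (((Real.sqrt 2 / γ : ℝ) : ℂ) * z)).mul_left
    ((((2 / (Real.pi * γ ^ 2)) ^ (1 / 4 : ℝ) : ℝ) : ℂ) * cexp (-z ^ 2 / (γ : ℂ) ^ 2) *
      cexp (-(x : ℂ) ^ 2 / (γ : ℂ) ^ 2))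
  have hv : cexp (-(x : ℂ) ^ 2 / (γ : ℂ) ^ 2 + -z ^ 2 / (γ : ℂ) ^ 2 +
      (((2 / γ * x : ℝ) : ℂ) * (((Real.sqrt 2 / γ : ℝ) : ℂ) * z) -
        (((Real.sqrt 2 / γ : ℝ) : ℂ) * z) ^ 2 / 2)) =
      cexp (-((x : ℂ) - (Real.sqrt 2 : ℂ) * z) ^ 2 / (γ : ℂ) ^ 2) := by
    congr 1
    push_cast
    field_simp
    linear_combination (z ^ 2) * h2
  rw [← hv, Complex.exp_add, Complex.exp_add, ← mul_assoc, ← mul_assoc,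
    mul_right_comm _ (cexp (-(x : ℂ) ^ 2 / (γ : ℂ) ^ 2))]
  refine cast (congrArg (fun f => HasSum f _) (funext fun n => ?_)) h
  have hq := congrArg (fun r : ℝ => (r : ℂ)) (sqrt_two_pow_div_mul_inv hγ n)
  rw [rbfBasis, hermiteFun, hs, show (2 / γ ^ 2 / Real.pi : ℝ) = 2 / (Real.pi * γ ^ 2) by
    field_simp, show -(2 / γ ^ 2) * x ^ 2 / 2 = -x ^ 2 / γ ^ 2 by ring]
  have ha : ((Polynomial.aeval (2 / γ * x : ℝ) (Polynomial.hermite n) : ℝ) : ℂ) =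
      Polynomial.aeval ((2 / γ * x : ℝ) : ℂ) (Polynomial.hermite n) :=
    (Polynomial.aeval_algebraMap_apply ℂ (2 / γ * x : ℝ) (Polynomial.hermite n)).symm
  rw [← ha, mul_pow]
  push_cast at hq ⊢
  linear_combination -(z ^ n * cexp (-z ^ 2 / (γ : ℂ) ^ 2) * cexp (-(x : ℂ) ^ 2 / (γ : ℂ) ^ 2) *
    (((2 / (Real.pi * γ ^ 2)) ^ (1 / 4 : ℝ) : ℝ) : ℂ) *
    (Polynomial.aeval (2 / γ * x : ℝ) (Polynomial.hermite n) : ℝ)) * hq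

theorem rbfKernel_eq {γ : ℝ} (hγ : 0 < γ) (z : ℂ) (x : ℝ) :
    rbfKernel γ z x = (((2 / (Real.pi * γ ^ 2)) ^ (1 / 4 : ℝ) : ℝ) : ℂ) *
      Complex.exp (-((x : ℂ) - (Real.sqrt 2 : ℂ) * z) ^ 2 / (γ : ℂ) ^ 2) :=
  (hasSum_rbfKernel_exp hγ z x).tsum_eq

theorem hasSum_rbfKernel {γ : ℝ} (hγ : 0 < γ) (z : ℂ) (x : ℝ) :
    HasSum (fun n : ℕ => rbfBasis γ n z * (hermiteFun (2 / γ ^ 2) n x : ℂ))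
      (rbfKernel γ z x) :=
  (hasSum_rbfKernel_exp hγ z x).summable.hasSum

/-! ### Plancherel on L¹ ∩ L². -/

open FourierTransform SchwartzMap ContDiff in
/-- On `L¹ ∩ L²` the `L²` Fourier transform is the Fourier integral. -/
theorem fourier_toLp_ae_eq {f : ℝ → ℂ} (h1 : Integrable f) (h2 : MemLp f 2) :
    ((𝓕 (h2.toLp f) : Lp ℂ 2 (volume : Measure ℝ)) : ℝ → ℂ) =ᵐ[volume] 𝓕 f := by
  have hc : Continuous (𝓕 f) := by
    exact VectorFourier.fourierIntegral_continuous Real.continuous_fourierChar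
      (by fun_prop) h1
  -- Both sides are compared through their pairings with test functions. In each pairing the Fourier
  -- transform moves onto the test function: on the left by compatibility with tempered
  -- distributions, on the right by Fubini.
  refine ae_eq_of_integral_contDiff_smul_eq
    ((Lp.memLp _).locallyIntegrable (by norm_num)) hc.locallyIntegrable fun g hg hgs => ?_
  have hs : HasCompactSupport (fun x => (g x : ℂ)) := hgs.comp_left (g := fun x : ℝ => (x : ℂ)) rfl
  have hgc : ContDiff ℝ ∞ (fun x => (g x : ℂ)) := Complex.ofRealCLM.contDiff.comp hg
  set φ : 𝓢(ℝ, ℂ) := hs.toSchwartzMap hgc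
  have hφ : ∀ x, φ x = (g x : ℂ) := fun x => rfl
  have e1 := congrArg (fun T => T φ) (Lp.fourier_toTemperedDistribution_eq (h2.toLp f))
  simp only [TemperedDistribution.fourier_apply, Lp.toTemperedDistribution_apply] at e1
  have e2 : ∫ x, (𝓕 φ) x • f x = ∫ x, φ x • 𝓕 f x := by
    simpa using! (VectorFourier.integral_fourierIntegral_smul_eq_flip (L := innerₗ ℝ)
      Real.continuous_fourierChar (by fun_prop) φ.integrable h1)
  have e3 : ∫ x, (𝓕 φ) x • (h2.toLp f) x = ∫ x, (𝓕 φ) x • f x :=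
    integral_congr_ae (by filter_upwards [h2.coeFn_toLp] with x hx; rw [hx])
  exact e1.symm.trans (e3.trans e2)

open FourierTransform in
/-- Plancherel's theorem on `L¹ ∩ L²`. -/
theorem lintegral_enorm_fourier_sq {f : ℝ → ℂ} (h1 : Integrable f) (h2 : MemLp f 2) :
    ∫⁻ v, ‖𝓕 f v‖ₑ ^ 2 = ∫⁻ x, ‖f x‖ₑ ^ 2 := by
  have h := Lp.norm_fourier_eq (h2.toLp f)
  have e : ∀ g : ℝ → ℂ, eLpNorm g 2 volume ^ 2 = ∫⁻ x, ‖g x‖ₑ ^ 2 := fun g => by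
    simpa using eLpNorm_nnreal_pow_eq_lintegral (μ := volume) (f := g) (p := 2) (by norm_num)
  rw [← e, ← e, ← eLpNorm_congr_ae (fourier_toLp_ae_eq h1 h2), ← eLpNorm_congr_ae h2.coeFn_toLp,
    ← Lp.enorm_def, ← Lp.enorm_def, ← ofReal_norm, ← ofReal_norm, h]

/-! ### Size of the kernel and holomorphy of the transform. -/

/-- Expanding the square isolates the mixed term exp(κzx), κ = 2√2/γ², which exhibits the transform
as a Laplace transform of a Gaussian times ψ. -/
theorem rbfKernel_eq_exp {γ : ℝ} (hγ : 0 < γ) (z : ℂ) (x : ℝ) :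
    rbfKernel γ z x = ((((2 / (Real.pi * γ ^ 2)) ^ (1 / 4 : ℝ) : ℝ) : ℂ) *
        cexp (-(2 * z ^ 2) / (γ : ℂ) ^ 2)) *
      (cexp (((2 * Real.sqrt 2 / γ ^ 2 : ℝ) : ℂ) * z * x) * cexp (-(x : ℂ) ^ 2 / (γ : ℂ) ^ 2)) := by
  have hγ' : (γ : ℂ) ≠ 0 := by exact_mod_cast hγ.ne'
  have h2 : (Real.sqrt 2 : ℂ) ^ 2 = 2 := by
    rw [← Complex.ofReal_pow, Real.sq_sqrt (by norm_num)]; norm_num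
  rw [rbfKernel_eq hγ, mul_assoc, ← Complex.exp_add, ← Complex.exp_add]
  congr 2
  push_cast
  field_simp
  linear_combination -z ^ 2 * h2

theorem continuous_rbfKernel {γ : ℝ} (hγ : 0 < γ) (z : ℂ) : Continuous (rbfKernel γ z) := by
  rw [funext (rbfKernel_eq hγ z)]
  fun_prop

theorem norm_rbfKernel {γ : ℝ} (hγ : 0 < γ) (z : ℂ) (x : ℝ) :
    ‖rbfKernel γ z x‖ = (2 / (Real.pi * γ ^ 2)) ^ (1 / 4 : ℝ) * Real.exp (2 * z.im ^ 2 / γ ^ 2) *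
      Real.exp (-(1 / γ ^ 2) * (x - Real.sqrt 2 * z.re) ^ 2) := by
  have h2 : Real.sqrt 2 ^ 2 = 2 := Real.sq_sqrt (by norm_num)
  rw [rbfKernel_eq hγ, norm_mul, Complex.norm_real, Real.norm_of_nonneg (by positivity),
    Complex.norm_exp, mul_assoc, ← Real.exp_add]
  congr 2
  rw [← Complex.ofReal_pow, Complex.div_ofReal_re]
  simp [sq]
  field_simp
  linear_combination (z.im ^ 2) * h2

theorem memLp_rbfKernel {γ : ℝ} (hγ : 0 < γ) (z : ℂ) :
    MemLp (rbfKernel γ z) 2 (volume : Measure ℝ) := by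
  rw [memLp_two_iff_integrable_sq_norm (continuous_rbfKernel hγ z).aestronglyMeasurable]
  have h := ((integrable_exp_neg_mul_sq (b := 2 / γ ^ 2) (by positivity)).comp_sub_right
    (Real.sqrt 2 * z.re)).const_mul
      (((2 / (Real.pi * γ ^ 2)) ^ (1 / 4 : ℝ) * Real.exp (2 * z.im ^ 2 / γ ^ 2)) ^ 2)
  refine h.congr (Filter.Eventually.of_forall fun x => ?_)
  simp only [norm_rbfKernel hγ, mul_pow, ← Real.exp_nat_mul]
  congr 2
  push_cast
  ring

theorem integrable_rbfKernel_mul {γ : ℝ} (hγ : 0 < γ) (z : ℂ) {ψ : ℝ → ℂ} (hψ : MemLp ψ 2) :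
    Integrable (fun x : ℝ => rbfKernel γ z x * ψ x) :=
  (memLp_rbfKernel hγ z).integrable_mul hψ

/-- The closed form has real coefficients. This is why the transform at z is an inner product with
the kernel function at conj z. -/
theorem conj_rbfKernel {γ : ℝ} (hγ : 0 < γ) (z : ℂ) (x : ℝ) :
    conj (rbfKernel γ z x) = rbfKernel γ (conj z) x := by
  simp [rbfKernel_eq hγ, ← Complex.exp_conj]

/-- The bilateral Laplace transform of a function which is integrable against all exponentials is
entire. -/
theorem differentiable_integral_cexp_mul {φ : ℝ → ℂ}
    (h : ∀ z : ℂ, Integrable (fun x : ℝ => cexp (z * x) * φ x)) :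
    Differentiable ℂ (fun z : ℂ => ∫ x : ℝ, cexp (z * x) * φ x) := by
  intro z₀
  -- One unit covers the ball of radius 1 around z₀; the other absorbs the factor |x| ≤ exp |x|
  -- produced by differentiation.
  set M : ℝ := |z₀.re| + 2
  have hb : Integrable (fun x : ℝ => ‖cexp ((M : ℂ) * x) * φ x‖ + ‖cexp (((-M : ℝ) : ℂ) * x) * φ x‖) :=
    (h M).norm.add (h ((-M : ℝ) : ℂ)).norm
  refine (hasDerivAt_integral_of_dominated_loc_of_deriv_le
    (F' := fun z x => (x : ℂ) * (cexp (z * x) * φ x))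
    (Metric.ball_mem_nhds z₀ one_pos)
    (Filter.Eventually.of_forall fun z => (h z).aestronglyMeasurable) (h z₀)
    ((by fun_prop : Continuous fun x : ℝ => (x : ℂ)).aestronglyMeasurable.mul
      (h z₀).aestronglyMeasurable) (Filter.Eventually.of_forall fun x z hz => ?_) hb
    (Filter.Eventually.of_forall fun x z _ => ?_)).2.differentiableAt
  · have hz' : |z.re - z₀.re| < 1 := by
      have := Complex.abs_re_le_norm (z - z₀)
      rw [Metric.mem_ball, dist_eq_norm] at hz
      simpa using this.trans_lt hz
    have hzr : |z.re| ≤ M - 1 := by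
      have := abs_sub_abs_le_abs_sub z.re z₀.re
      simp only [M]; linarith
    simp only [norm_mul, Complex.norm_exp, Complex.norm_real, Real.norm_eq_abs, ← mul_assoc,
      ← add_mul]
    refine mul_le_mul_of_nonneg_right ?_ (norm_nonneg _)
    have e : ∀ a : ℂ, (a * (x : ℂ)).re = a.re * x := fun a => by simp
    rw [e, e, e, Complex.ofReal_re, Complex.ofReal_re]
    have h1 : |x| ≤ Real.exp |x| := by linarith [Real.add_one_le_exp |x|]
    have h2 : z.re * x ≤ (M - 1) * |x| := by
      refine (le_abs_self _).trans ?_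
      rw [abs_mul]
      exact mul_le_mul_of_nonneg_right hzr (abs_nonneg x)
    calc |x| * Real.exp (z.re * x) ≤ Real.exp |x| * Real.exp ((M - 1) * |x|) :=
          mul_le_mul h1 (Real.exp_le_exp.mpr h2) (Real.exp_pos _).le (Real.exp_pos _).le
      _ = Real.exp (M * |x|) := by rw [← Real.exp_add]; ring_nf
      _ ≤ Real.exp (M * x) + Real.exp (-M * x) := by
          rcases abs_cases x with ⟨hx, _⟩ | ⟨hx, _⟩ <;> rw [hx]
          · linarith [Real.exp_pos (-M * x)]
          · rw [mul_neg, ← neg_mul]; linarith [Real.exp_pos (M * x)]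
  · have h1 : HasDerivAt (fun z : ℂ => z * (x : ℂ)) x z := by
      simpa using (hasDerivAt_id z).mul_const (x : ℂ)
    exact (h1.cexp.mul_const (φ x)).congr_deriv (by ring)

theorem rbfTransform_eq_laplace {γ : ℝ} (hγ : 0 < γ) (ψ : ℝ → ℂ) (z : ℂ) :
    rbfTransform γ ψ z = ((((2 / (Real.pi * γ ^ 2)) ^ (1 / 4 : ℝ) : ℝ) : ℂ) *
        cexp (-(2 * z ^ 2) / (γ : ℂ) ^ 2)) *
      ∫ x : ℝ, cexp (((2 * Real.sqrt 2 / γ ^ 2 : ℝ) : ℂ) * z * x) *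
        (cexp (-(x : ℂ) ^ 2 / (γ : ℂ) ^ 2) * ψ x) := by
  rw [rbfTransform, ← integral_const_mul]
  congr 1 with x
  rw [rbfKernel_eq_exp hγ]
  ring

theorem differentiable_rbfTransform {γ : ℝ} (hγ : 0 < γ) {ψ : ℝ → ℂ} (hψ : MemLp ψ 2) :
    Differentiable ℂ (rbfTransform γ ψ) := by
  have hκ : ((2 * Real.sqrt 2 / γ ^ 2 : ℝ) : ℂ) ≠ 0 := by
    rw [Complex.ofReal_ne_zero]; positivity
  have hc : (((2 / (Real.pi * γ ^ 2)) ^ (1 / 4 : ℝ) : ℝ) : ℂ) ≠ 0 := by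
    rw [Complex.ofReal_ne_zero]; positivity
  have hint : ∀ z : ℂ, Integrable
      (fun x : ℝ => cexp (z * x) * (cexp (-(x : ℂ) ^ 2 / (γ : ℂ) ^ 2) * ψ x)) := by
    intro z
    -- Every exponent z is κw for some w, so integrability follows from that of the kernel at w
    -- times ψ.
    set w := z / ((2 * Real.sqrt 2 / γ ^ 2 : ℝ) : ℂ) with hw
    have hz : z = ((2 * Real.sqrt 2 / γ ^ 2 : ℝ) : ℂ) * w := by rw [hw, mul_div_cancel₀ _ hκ]
    have hne := mul_ne_zero hc (Complex.exp_ne_zero (-(2 * w ^ 2) / (γ : ℂ) ^ 2))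
    refine ((integrable_rbfKernel_mul hγ w hψ).const_mul
      ((((2 / (Real.pi * γ ^ 2)) ^ (1 / 4 : ℝ) : ℝ) : ℂ) *
        cexp (-(2 * w ^ 2) / (γ : ℂ) ^ 2))⁻¹).congr (Filter.Eventually.of_forall fun x => ?_)
    beta_reduce
    rw [rbfKernel_eq_exp hγ, ← hz, mul_assoc, inv_mul_cancel_left₀ hne, mul_assoc]
  have h := (differentiable_integral_cexp_mul hint).comp
    (differentiable_id.const_mul ((2 * Real.sqrt 2 / γ ^ 2 : ℝ) : ℂ))
  rw [funext (rbfTransform_eq_laplace hγ ψ)]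
  exact (by fun_prop : Differentiable ℂ fun z : ℂ =>
    ((((2 / (Real.pi * γ ^ 2)) ^ (1 / 4 : ℝ) : ℝ) : ℂ) * cexp (-(2 * z ^ 2) / (γ : ℂ) ^ 2))).mul h

/-! ### The norm identity via windowed Fourier transforms. -/

theorem Real.lintegral_comp_mul_left {F : ℝ → ENNReal} (hF : Measurable F) {a : ℝ} (ha : a ≠ 0) :
    ∫⁻ v, F (a * v) = ENNReal.ofReal |a⁻¹| * ∫⁻ v, F v := by
  rw [← smul_eq_mul, ← lintegral_smul_measure, ← Real.map_volume_mul_left ha,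
    lintegral_map hF (measurable_const_mul a)]

open FourierTransform in
theorem continuous_fourier_of_integrable {f : ℝ → ℂ} (hf : Integrable f) : Continuous (𝓕 f) :=
  VectorFourier.fourierIntegral_continuous Real.continuous_fourierChar (L := innerₗ ℝ)
    (by fun_prop) hf

/-- The function `ψ` localized by a Gaussian window. -/
noncomputable def gaussWindow (γ : ℝ) (ψ : ℝ → ℂ) (u x : ℝ) : ℂ :=
  (Real.exp (-(1 / γ ^ 2) * (x - Real.sqrt 2 * u) ^ 2) : ℂ) * ψ x

theorem memLp_two_gaussian {b : ℝ} (hb : 0 < b) (a : ℝ) :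
    MemLp (fun x : ℝ => (Real.exp (-b * (x - a) ^ 2) : ℂ)) 2 := by
  rw [memLp_two_iff_integrable_sq_norm (by fun_prop)]
  refine ((integrable_exp_neg_mul_sq (b := 2 * b) (by positivity)).comp_sub_right a).congr
    (Filter.Eventually.of_forall fun x => ?_)
  simp only [Complex.norm_real, Real.norm_eq_abs, Real.abs_exp, ← Real.exp_nat_mul]
  congr 1
  push_cast
  ring

theorem integrable_gaussWindow {γ : ℝ} (hγ : 0 < γ) {ψ : ℝ → ℂ} (hψ : MemLp ψ 2) (u : ℝ) :
    Integrable (gaussWindow γ ψ u) :=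
  (memLp_two_gaussian (by positivity) _).integrable_mul hψ

theorem memLp_gaussWindow {γ : ℝ} {ψ : ℝ → ℂ} (hψ : MemLp ψ 2) (u : ℝ) :
    MemLp (gaussWindow γ ψ u) 2 := by
  refine hψ.mono (AEStronglyMeasurable.mul (by fun_prop) hψ.aestronglyMeasurable)
    (Filter.Eventually.of_forall fun x => ?_)
  rw [gaussWindow, norm_mul, Complex.norm_real, Real.norm_eq_abs, Real.abs_exp]
  refine mul_le_of_le_one_left (norm_nonneg _) (Real.exp_le_one_iff.mpr ?_)
  rw [neg_mul, neg_nonpos]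
  positivity

open FourierTransform in
/-- The RBF transform is a windowed Fourier transform. -/
theorem norm_rbfTransform {γ : ℝ} (hγ : 0 < γ) (ψ : ℝ → ℂ) (u v : ℝ) :
    ‖rbfTransform γ ψ (u + v * I)‖ = (2 / (Real.pi * γ ^ 2)) ^ (1 / 4 : ℝ) *
      Real.exp (2 * v ^ 2 / γ ^ 2) *
        ‖𝓕 (gaussWindow γ ψ u) (-(Real.sqrt 2 / (Real.pi * γ ^ 2)) * v)‖ := by
  have hγ' : (γ : ℂ) ≠ 0 := by exact_mod_cast hγ.ne'
  have hπ : (Real.pi : ℂ) ≠ 0 := by exact_mod_cast Real.pi_ne_zero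
  have h2 : (Real.sqrt 2 : ℂ) ^ 2 = 2 := by
    rw [← Complex.ofReal_pow, Real.sq_sqrt (by norm_num)]; norm_num
  -- With z = u + iv, -(x - √2 z)² = -(x - √2 u)² + 2√2 ivx - 4iuv + 2v². The term in vx is the
  -- Fourier character, which fixes the frequency -√2 v/(πγ²); the term in uv is a pure phase.
  have h : rbfTransform γ ψ (u + v * I) =
      (((2 / (Real.pi * γ ^ 2)) ^ (1 / 4 : ℝ) * Real.exp (2 * v ^ 2 / γ ^ 2) : ℝ) : ℂ) *
      cexp ((-(4 * u * v / γ ^ 2) : ℝ) * I) *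
      𝓕 (gaussWindow γ ψ u) (-(Real.sqrt 2 / (Real.pi * γ ^ 2)) * v) := by
    rw [Real.fourier_real_eq_integral_exp_smul, ← integral_const_mul, rbfTransform]
    congr 1 with x
    rw [rbfKernel_eq hγ, gaussWindow, smul_eq_mul, ← mul_assoc, ← mul_assoc]
    congr 1
    rw [Complex.ofReal_mul, Complex.ofReal_exp, Complex.ofReal_exp, mul_assoc _ (cexp _) (cexp _),
      mul_assoc, mul_assoc, ← Complex.exp_add, mul_assoc, ← Complex.exp_add, ← Complex.exp_add]
    congr 2
    push_cast
    field_simp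
    linear_combination (-u ^ 2 - 2 * u * v * I - v ^ 2 * I ^ 2 + u ^ 2) * h2 - 2 * v ^ 2 * I_sq
  rw [h, norm_mul, norm_mul, Complex.norm_exp_ofReal_mul_I, mul_one, Complex.norm_real,
    Real.norm_of_nonneg (by positivity)]

open FourierTransform in
-- The squared growth factor exp(4v²/γ²) is the inverse of the weight, so only a constant and the
-- Fourier transform survive.
theorem enorm_rbfTransform_sq_mul_weight {γ : ℝ} (hγ : 0 < γ) (ψ : ℝ → ℂ) (u v : ℝ) :
    ‖rbfTransform γ ψ (u + v * I)‖ₑ ^ 2 * ENNReal.ofReal (rbfWeight γ (u + v * I)) =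
      ENNReal.ofReal (Real.sqrt (2 / (Real.pi * γ ^ 2))) *
        ‖𝓕 (gaussWindow γ ψ u) (-(Real.sqrt 2 / (Real.pi * γ ^ 2)) * v)‖ₑ ^ 2 := by
  rw [← ofReal_norm, ← ofReal_norm, ← ENNReal.ofReal_pow (norm_nonneg _),
    ← ENNReal.ofReal_pow (norm_nonneg _), ← ENNReal.ofReal_mul (by positivity),
    ← ENNReal.ofReal_mul (by positivity), norm_rbfTransform hγ]
  congr 1
  have h1 : ((2 / (Real.pi * γ ^ 2)) ^ (1 / 4 : ℝ)) ^ 2 = Real.sqrt (2 / (Real.pi * γ ^ 2)) := by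
    rw [Real.sqrt_eq_rpow, ← Real.rpow_natCast, ← Real.rpow_mul (by positivity)]
    norm_num
  have h2 : Real.exp (2 * v ^ 2 / γ ^ 2) ^ 2 * rbfWeight γ (u + v * I) = 1 := by
    rw [rbfWeight, ← Real.exp_nat_mul, ← Real.exp_add]
    simp
    ring
  rw [mul_pow, mul_pow, h1]
  linear_combination (Real.sqrt (2 / (Real.pi * γ ^ 2)) *
    ‖𝓕 (gaussWindow γ ψ u) (-(Real.sqrt 2 / (Real.pi * γ ^ 2)) * v)‖ ^ 2) * h2

/-- As a function of u the squared window is a Gaussian centred at x/√2, whose total mass does not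
depend on x. -/
theorem lintegral_gaussWindow {γ : ℝ} (hγ : 0 < γ) (ψ : ℝ → ℂ) (x : ℝ) :
    ∫⁻ u, ‖gaussWindow γ ψ u x‖ₑ ^ 2 =
      ENNReal.ofReal (Real.sqrt (Real.pi / (4 / γ ^ 2))) * ‖ψ x‖ₑ ^ 2 := by
  have hg := (integrable_exp_neg_mul_sq (b := 4 / γ ^ 2) (by positivity)).comp_sub_right
    (x / Real.sqrt 2)
  have h2 : Real.sqrt 2 ^ 2 = 2 := Real.sq_sqrt (by norm_num)
  have h : ∀ u, ‖gaussWindow γ ψ u x‖ₑ ^ 2 =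
      ENNReal.ofReal (Real.exp (-(4 / γ ^ 2) * (u - x / Real.sqrt 2) ^ 2)) * ‖ψ x‖ₑ ^ 2 := by
    intro u
    rw [gaussWindow, enorm_mul, mul_pow, ← ofReal_norm, Complex.norm_real, Real.norm_eq_abs,
      Real.abs_exp, ← ENNReal.ofReal_pow (Real.exp_pos _).le, ← Real.exp_nat_mul]
    congr 3
    have : Real.sqrt 2 ≠ 0 := by positivity
    push_cast
    field_simp
    rw [h2]
    ring
  simp_rw [h]
  rw [lintegral_mul_const _ (by fun_prop), ← ofReal_integral_eq_lintegral_ofReal hg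
    (Filter.Eventually.of_forall fun u => (Real.exp_pos _).le),
    integral_sub_right_eq_self (fun u => Real.exp (-(4 / γ ^ 2) * u ^ 2)), integral_gaussian]

/-- Plancherel in v for fixed u, then Tonelli and integration over the window centres u. Integrals
with values in [0, ∞] need no prior integrability of the transform; finiteness is a consequence. -/
theorem lintegral_enorm_rbfTransform {γ : ℝ} (hγ : 0 < γ) {ψ : ℝ → ℂ} (hψ : MemLp ψ 2) :
    ∫⁻ z, ‖rbfTransform γ ψ z‖ₑ ^ 2 * ENNReal.ofReal (rbfWeight γ z) =
      ENNReal.ofReal (Real.pi * γ ^ 2 / 2) * ∫⁻ x, ‖ψ x‖ₑ ^ 2 := by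
  have hc := (differentiable_rbfTransform hγ hψ).continuous
  have hw := continuous_rbfWeight γ
  have hm : Measurable fun z => ‖rbfTransform γ ψ z‖ₑ ^ 2 * ENNReal.ofReal (rbfWeight γ z) := by
    fun_prop
  have hk : -(Real.sqrt 2 / (Real.pi * γ ^ 2)) ≠ 0 := by
    have : Real.sqrt 2 / (Real.pi * γ ^ 2) ≠ 0 := by positivity
    simpa using this
  have hpair : ∀ p : ℝ × ℝ, Complex.measurableEquivRealProd.symm p = p.1 + p.2 * I := fun p => by
    simp [Complex.measurableEquivRealProd, Complex.ext_iff]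
  have hmz : Measurable (Function.uncurry fun u x : ℝ =>
      Real.exp (-(1 / γ ^ 2) * (x - Real.sqrt 2 * u) ^ 2)) := by
    unfold Function.uncurry; fun_prop
  rw [← Complex.volume_preserving_equiv_real_prod.symm.lintegral_comp hm]
  have hmp : Measurable fun p : ℝ × ℝ => ‖rbfTransform γ ψ (p.1 + p.2 * I)‖ₑ ^ 2 *
      ENNReal.ofReal (rbfWeight γ (p.1 + p.2 * I)) :=
    hm.comp (by fun_prop : Measurable fun p : ℝ × ℝ => (p.1 : ℂ) + p.2 * I)
  simp only [hpair]
  rw [Measure.volume_eq_prod, lintegral_prod _ hmp.aemeasurable]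
  simp only [enorm_rbfTransform_sq_mul_weight hγ]
  have hin : ∀ u : ℝ, ∫⁻ v, ENNReal.ofReal (Real.sqrt (2 / (Real.pi * γ ^ 2))) *
        ‖FourierTransform.fourier (gaussWindow γ ψ u) (-(Real.sqrt 2 / (Real.pi * γ ^ 2)) * v)‖ₑ ^ 2
      = ENNReal.ofReal (Real.sqrt (2 / (Real.pi * γ ^ 2)) * |(-(Real.sqrt 2 / (Real.pi * γ ^ 2)))⁻¹|) *
        ∫⁻ x, ‖gaussWindow γ ψ u x‖ₑ ^ 2 := by
    intro u
    have hfc := continuous_fourier_of_integrable (integrable_gaussWindow hγ hψ u)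
    have hfm := hfc.measurable.enorm.pow_const 2
    rw [lintegral_const_mul' _ _ ENNReal.ofReal_ne_top, Real.lintegral_comp_mul_left
      (F := fun v => ‖FourierTransform.fourier (gaussWindow γ ψ u) v‖ₑ ^ 2) hfm hk,
      lintegral_enorm_fourier_sq (integrable_gaussWindow hγ hψ u) (memLp_gaussWindow hψ u),
      ENNReal.ofReal_mul (by positivity), mul_assoc]
  simp_rw [hin]
  rw [lintegral_const_mul' _ _ ENNReal.ofReal_ne_top, lintegral_lintegral_swap]
  · simp_rw [lintegral_gaussWindow hγ]
    rw [lintegral_const_mul' _ _ ENNReal.ofReal_ne_top, ← mul_assoc, ← ENNReal.ofReal_mul (by positivity)]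
    congr 2
    rw [inv_neg, abs_neg, abs_of_pos (by positivity), Real.sqrt_div (by norm_num),
      Real.sqrt_mul Real.pi_pos.le, Real.sqrt_sq hγ.le, Real.sqrt_div Real.pi_pos.le,
      show (4 / γ ^ 2) = (2 / γ) ^ 2 by ring, Real.sqrt_sq (by positivity)]
    have : Real.sqrt Real.pi ≠ 0 := by positivity
    field_simp
  · have h2 : AEMeasurable (fun p : ℝ × ℝ => ψ p.2) (volume.prod volume) :=
      hψ.aestronglyMeasurable.aemeasurable.comp_snd
    exact (((Complex.measurable_ofReal.comp hmz).aemeasurable.mul h2).enorm).pow_const 2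

/-! ### Mean values, reproducing kernels and point evaluation. -/

/-- The circle mean value property of s ↦ F(sz) on the unit circle; this form also covers z = 0. -/
theorem intervalIntegral_cexp_mul_eq {F : ℂ → ℂ} (hF : Differentiable ℂ F) (z : ℂ) :
    ∫ θ in (0 : ℝ)..2 * Real.pi, F (cexp (θ * I) * z) = 2 * Real.pi * F 0 := by
  have hG : Differentiable ℂ fun s => F (s * z) := hF.comp (by fun_prop)
  have h := (hG.diffContOnCl (s := Metric.ball 0 |1|)).circleAverage
  rw [Real.circleAverage_def] at h
  simp only [circleMap_zero, ofReal_one, one_mul, zero_mul, Complex.real_smul] at h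
  rw [← h, ← mul_assoc, ← Complex.ofReal_ofNat, ← Complex.ofReal_mul, ← Complex.ofReal_mul,
    mul_inv_cancel₀ (by positivity), Complex.ofReal_one, one_mul]

/-- The mean value property of an entire function with respect to a radial weight. -/
theorem integral_mul_radial {F : ℂ → ℂ} (hF : Differentiable ℂ F) {w : ℝ → ℝ} (hw : Continuous w)
    (hint : Integrable (fun z => F z * (w ‖z‖ : ℂ))) :
    ∫ z, F z * (w ‖z‖ : ℂ) = F 0 * ∫ z : ℂ, (w ‖z‖ : ℂ) := by
  have hFc := hF.continuous
  -- Rotations preserve area and ‖z‖, so the integral equals its average over all angles. Fubini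
  -- then lets the circle mean replace F by F 0.
  have hrot : ∀ θ : ℝ, (fun z : ℂ => F (cexp (θ * I) * z) * (w ‖z‖ : ℂ)) =
      (fun z => F z * (w ‖z‖ : ℂ)) ∘ rotation (Circle.exp θ) := fun θ => by
    ext z
    simp [rotation_apply]
  have hmp : ∀ θ : ℝ, MeasurePreserving (rotation (Circle.exp θ)) (volume : Measure ℂ) volume :=
    fun θ => LinearIsometryEquiv.measurePreserving _
  have hemb : ∀ θ : ℝ, MeasurableEmbedding (rotation (Circle.exp θ)) := fun θ =>
    (rotation (Circle.exp θ)).toHomeomorph.measurableEmbedding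
  have hθ : ∀ θ : ℝ, ∫ z, F (cexp (θ * I) * z) * (w ‖z‖ : ℂ) = ∫ z, F z * (w ‖z‖ : ℂ) := fun θ => by
    rw [hrot]
    exact (hmp θ).integral_comp (hemb θ) (fun z => F z * (w ‖z‖ : ℂ))
  have hprod : Integrable (Function.uncurry fun (θ : ℝ) (z : ℂ) =>
      F (cexp (θ * I) * z) * (w ‖z‖ : ℂ)) ((volume.restrict (Set.uIoc 0 (2 * Real.pi))).prod volume) := by
    have hm : Continuous (Function.uncurry fun (θ : ℝ) (z : ℂ) =>
      F (cexp (θ * I) * z) * (w ‖z‖ : ℂ)) := by unfold Function.uncurry; fun_prop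
    rw [integrable_prod_iff hm.aestronglyMeasurable]
    refine ⟨Filter.Eventually.of_forall fun θ => ?_, ?_⟩
    · simp only [Function.uncurry_apply_pair, hrot]
      exact ((hmp θ).integrable_comp_emb (hemb θ)).mpr hint
    · have : ∀ θ : ℝ, ∫ z, ‖F (cexp (θ * I) * z) * (w ‖z‖ : ℂ)‖ = ∫ z, ‖F z * (w ‖z‖ : ℂ)‖ := by
        intro θ
        rw [← (hmp θ).integral_comp (hemb θ) (fun z => ‖F z * (w ‖z‖ : ℂ)‖)]
        exact integral_congr_ae (Filter.Eventually.of_forall fun z =>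
          congrArg norm (congrFun (hrot θ) z))
      simp only [Function.uncurry_apply_pair, this]
      rw [Set.uIoc_of_le Real.two_pi_pos.le]
      exact integrable_const _
  have hsw := MeasureTheory.integral_integral_swap hprod
  have hs2 : ∫ θ in (0 : ℝ)..2 * Real.pi, ∫ z, F (cexp (θ * I) * z) * (w ‖z‖ : ℂ) =
      ∫ z, ∫ θ in (0 : ℝ)..2 * Real.pi, F (cexp (θ * I) * z) * (w ‖z‖ : ℂ) := by
    simpa [intervalIntegral.integral_of_le Real.two_pi_pos.le,
      Set.uIoc_of_le Real.two_pi_pos.le] using hsw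
  simp only [hθ, intervalIntegral.integral_const, intervalIntegral.integral_mul_const,
    intervalIntegral_cexp_mul_eq hF, integral_const_mul, sub_zero, Complex.real_smul] at hs2
  have hπ : (Real.pi : ℂ) ≠ 0 := by exact_mod_cast Real.pi_ne_zero
  push_cast at hs2
  exact mul_left_cancel₀ (mul_ne_zero two_ne_zero hπ) (by rw [hs2, mul_assoc])

/-- The transform of the conjugate kernel function is, up to a constant, the reproducing kernel of
the RBF space. -/
theorem rbfTransform_rbfKernel {γ : ℝ} (hγ : 0 < γ) : ∃ C : ℂ, C ≠ 0 ∧ ∀ w z : ℂ,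
    rbfTransform γ (rbfKernel γ w) z =
      C * cexp ((-z ^ 2 - w ^ 2 + 2 * z * w) / (γ : ℂ) ^ 2) := by
  have hγ' : (γ : ℂ) ≠ 0 := by exact_mod_cast hγ.ne'
  have hπ : (Real.pi : ℂ) ≠ 0 := by exact_mod_cast Real.pi_ne_zero
  have hc : (((2 / (Real.pi * γ ^ 2)) ^ (1 / 4 : ℝ) : ℝ) : ℂ) ≠ 0 := by
    rw [Complex.ofReal_ne_zero]; positivity
  have h2 : (Real.sqrt 2 : ℂ) ^ 2 = 2 := by
    rw [← Complex.ofReal_pow, Real.sq_sqrt (by norm_num)]; norm_num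
  -- The square of the kernel's constant times the constant of the Gaussian integral in x; only its
  -- nonvanishing matters later.
  refine ⟨(((2 / (Real.pi * γ ^ 2)) ^ (1 / 4 : ℝ) : ℝ) : ℂ) ^ 2 *
    (Real.pi / -((-2 / γ ^ 2 : ℝ) : ℂ)) ^ (1 / 2 : ℂ), ?_, fun w z => ?_⟩
  · refine mul_ne_zero (pow_ne_zero _ hc) ?_
    rw [Complex.cpow_def_of_ne_zero]
    · exact Complex.exp_ne_zero _
    · push_cast
      simp [hπ, hγ']
  · have hb : ((-2 / γ ^ 2 : ℝ) : ℂ).re < 0 := by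
      rw [Complex.ofReal_re]
      exact div_neg_of_neg_of_pos (by norm_num) (by positivity)
    have hq := integral_cexp_quadratic hb (2 * Real.sqrt 2 * (z + w) / (γ : ℂ) ^ 2)
      (-2 * (z ^ 2 + w ^ 2) / (γ : ℂ) ^ 2)
    have he : (-2 * (z ^ 2 + w ^ 2) / (γ : ℂ) ^ 2) - (2 * Real.sqrt 2 * (z + w) / (γ : ℂ) ^ 2) ^ 2 /
        (4 * ((-2 / γ ^ 2 : ℝ) : ℂ)) = (-z ^ 2 - w ^ 2 + 2 * z * w) / (γ : ℂ) ^ 2 := by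
      push_cast
      field_simp
      linear_combination 2 * (z + w) ^ 2 * h2
    rw [he] at hq
    rw [mul_assoc, ← hq, ← integral_const_mul, rbfTransform]
    congr 1 with x
    rw [rbfKernel_eq hγ, rbfKernel_eq hγ, mul_mul_mul_comm, ← sq, ← Complex.exp_add]
    congr 2
    push_cast
    field_simp
    linear_combination (-z ^ 2 - w ^ 2) * h2

/-- A function in the RBF space that is orthogonal to the reproducing kernel at `w` vanishes at
`w`. -/
theorem RBFSpace.apply_eq_zero_of_inner_eq_zero {γ : ℝ} {hγ : 0 < γ} (K f : RBFSpace γ hγ) {C w : ℂ}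
    (hC : C ≠ 0) (hK : ∀ z, K z = C * cexp ((-z ^ 2 - conj w ^ 2 + 2 * z * conj w) / (γ : ℂ) ^ 2))
    (h : inner ℂ K f = 0) : f w = 0 := by
  have hγ' : (γ : ℂ) ≠ 0 := by exact_mod_cast hγ.ne'
  have hf := f.differentiable
  -- With z = ζ + w, the exponents of conj K and of the weight add up to (z² - w² - 2ζ conj w -
  -- 2|ζ|²)/γ²: conj ζ survives only in |ζ|². The remaining factor F is entire, with F 0 = conj C *
  -- f w.
  set F : ℂ → ℂ := fun ζ => conj C * cexp (-w ^ 2 / (γ : ℂ) ^ 2) *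
    (f (ζ + w) * cexp ((ζ + w) ^ 2 / (γ : ℂ) ^ 2 - 2 * conj w * ζ / (γ : ℂ) ^ 2))
  have hFd : Differentiable ℂ F := by
    have : Differentiable ℂ fun ζ => f (ζ + w) := hf.comp (by fun_prop)
    fun_prop
  set g : ℝ → ℝ := fun r => Real.exp (-(2 / γ ^ 2) * r ^ 2)
  have hpt : ∀ ζ, conj (K (ζ + w)) * f (ζ + w) * (rbfWeight γ (ζ + w) : ℂ) = F ζ * (g ‖ζ‖ : ℂ) := by
    intro ζ
    have hn : (((‖ζ‖ ^ 2 : ℝ)) : ℂ) = ζ * conj ζ := by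
      rw [Complex.mul_conj, Complex.normSq_eq_norm_sq]
    have hexp : cexp (conj ((-(ζ + w) ^ 2 - conj w ^ 2 + 2 * (ζ + w) * conj w) / (γ : ℂ) ^ 2)) *
        cexp (((ζ + w) - conj (ζ + w)) ^ 2 / (γ : ℂ) ^ 2) =
        cexp (-w ^ 2 / (γ : ℂ) ^ 2) *
          cexp ((ζ + w) ^ 2 / (γ : ℂ) ^ 2 - 2 * conj w * ζ / (γ : ℂ) ^ 2) *
          cexp ((-(2 / γ ^ 2) * ‖ζ‖ ^ 2 : ℝ) : ℂ) := by
      rw [← Complex.exp_add, ← Complex.exp_add, ← Complex.exp_add, Complex.ofReal_mul, hn]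
      congr 1
      simp only [map_div₀, map_add, map_sub, map_neg, map_mul, map_pow, Complex.conj_conj,
        Complex.conj_ofReal, map_ofNat]
      push_cast
      field_simp
      ring
    rw [hK, rbfWeight_eq, map_mul, ← Complex.exp_conj, Complex.ofReal_exp]
    linear_combination conj C * f (ζ + w) * hexp
  have hint := rbf_integrable_conj_mul K.differentiable hf K.integrable f.integrable
  have hint2 := (hint.comp_add_right w).congr (Filter.Eventually.of_forall hpt)
  rw [RBFSpace.inner_def] at h
  have hc : (((2 / (Real.pi * γ ^ 2) : ℝ) : ℂ)) ≠ 0 := by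
    rw [Complex.ofReal_ne_zero]; positivity
  have h0 := (mul_eq_zero.mp h).resolve_left hc
  rw [← integral_add_right_eq_self _ w, integral_congr_ae (Filter.Eventually.of_forall hpt),
    integral_mul_radial hFd (by fun_prop) hint2] at h0
  have hI : (∫ z : ℂ, (g ‖z‖ : ℂ)) ≠ 0 := by
    rw [integral_complex_ofReal, Complex.ofReal_ne_zero,
      GaussianFourier.integral_rexp_neg_mul_sq_norm (by positivity)]
    positivity
  have hF0 := (mul_eq_zero.mp h0).resolve_right hI
  simpa [F, hC, Complex.exp_ne_zero] using hF0

/-! ### The isometry, its surjectivity and the final assembly. -/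

theorem integrable_norm_rbfTransform_sq {γ : ℝ} (hγ : 0 < γ) {ψ : ℝ → ℂ} (hψ : MemLp ψ 2) :
    Integrable (fun z => ‖rbfTransform γ ψ z‖ ^ 2 * rbfWeight γ z) ∧
      ∫ z, ‖rbfTransform γ ψ z‖ ^ 2 * rbfWeight γ z =
        Real.pi * γ ^ 2 / 2 * (eLpNorm ψ 2 volume).toReal ^ 2 := by
  have hc := (differentiable_rbfTransform hγ hψ).continuous
  have hw := continuous_rbfWeight γ
  have hm : AEStronglyMeasurable (fun z => ‖rbfTransform γ ψ z‖ ^ 2 * rbfWeight γ z) volume :=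
    Continuous.aestronglyMeasurable (by fun_prop)
  have h0 : ∀ z, 0 ≤ ‖rbfTransform γ ψ z‖ ^ 2 * rbfWeight γ z := fun z =>
    mul_nonneg (sq_nonneg _) (rbfWeight_pos γ z).le
  have e : eLpNorm ψ 2 volume ^ 2 = ∫⁻ x, ‖ψ x‖ₑ ^ 2 := by
    simpa using eLpNorm_nnreal_pow_eq_lintegral (μ := volume) (f := ψ) (p := 2) (by norm_num)
  have h : ∫⁻ z, ENNReal.ofReal (‖rbfTransform γ ψ z‖ ^ 2 * rbfWeight γ z) =
      ENNReal.ofReal (Real.pi * γ ^ 2 / 2) * eLpNorm ψ 2 volume ^ 2 := by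
    rw [e, ← lintegral_enorm_rbfTransform hγ hψ]
    congr 1 with z
    rw [ENNReal.ofReal_mul (sq_nonneg _), ENNReal.ofReal_pow (norm_nonneg _), ofReal_norm]
  refine ⟨⟨hm, ?_⟩, ?_⟩
  · rw [hasFiniteIntegral_iff_ofReal (Filter.Eventually.of_forall h0), h]
    exact ENNReal.mul_lt_top ENNReal.ofReal_lt_top (ENNReal.pow_lt_top hψ.eLpNorm_lt_top)
  · rw [integral_eq_lintegral_of_nonneg_ae (Filter.Eventually.of_forall h0) hm, h,
      ENNReal.toReal_mul, ENNReal.toReal_ofReal (by positivity), ENNReal.toReal_pow]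

theorem rbfTransform_congr_ae {γ : ℝ} {ψ φ : ℝ → ℂ} (h : ψ =ᵐ[volume] φ) :
    rbfTransform γ ψ = rbfTransform γ φ := by
  ext z
  refine integral_congr_ae ?_
  filter_upwards [h] with x hx
  rw [hx]

/-- The RBF Segal-Bargmann transform as a linear isometry. -/
noncomputable def rbfIsometry {γ : ℝ} (hγ : 0 < γ) :
    Lp ℂ 2 (volume : Measure ℝ) →ₗᵢ[ℂ] RBFSpace γ hγ where
  toFun ψ := ⟨rbfTransform γ ψ, differentiable_rbfTransform hγ (Lp.memLp ψ),
    (integrable_norm_rbfTransform_sq hγ (Lp.memLp ψ)).1⟩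
  map_add' ψ φ := by
    refine RBFSpace.ext_fun fun z => ?_
    change rbfTransform γ _ z = rbfTransform γ ψ z + rbfTransform γ φ z
    rw [rbfTransform_congr_ae (Lp.coeFn_add ψ φ), rbfTransform, rbfTransform, rbfTransform,
      ← integral_add (integrable_rbfKernel_mul hγ z (Lp.memLp ψ))
        (integrable_rbfKernel_mul hγ z (Lp.memLp φ))]
    simp only [Pi.add_apply, mul_add]
  map_smul' c ψ := by
    refine RBFSpace.ext_fun fun z => ?_
    change rbfTransform γ _ z = c * rbfTransform γ ψ z
    rw [rbfTransform_congr_ae (Lp.coeFn_smul c ψ), rbfTransform, rbfTransform,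
      ← integral_const_mul]
    simp only [Pi.smul_apply, smul_eq_mul, mul_left_comm]
  norm_map' ψ := by
    refine (sq_eq_sq₀ (norm_nonneg _) (norm_nonneg _)).mp ?_
    rw [RBFSpace.norm_sq_eq]
    change 2 / (Real.pi * γ ^ 2) * ∫ z, ‖rbfTransform γ ψ z‖ ^ 2 * rbfWeight γ z = _
    rw [(integrable_norm_rbfTransform_sq hγ (Lp.memLp ψ)).2, Lp.norm_def]
    field_simp

theorem rbfIsometry_apply {γ : ℝ} (hγ : 0 < γ) (ψ : Lp ℂ 2 (volume : Measure ℝ)) (z : ℂ) :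
    rbfIsometry hγ ψ z = rbfTransform γ ψ z := rfl

theorem rbfIsometry_surjective {γ : ℝ} (hγ : 0 < γ) : Function.Surjective (rbfIsometry hγ) := by
  set R := LinearMap.range (rbfIsometry hγ).toLinearMap with hR
  -- Completeness of the range comes from L²(ℝ) and suffices for orthogonal decomposition, so
  -- completeness of the RBF space is not needed beforehand.
  have hcomp : IsComplete (R : Set (RBFSpace γ hγ)) := by
    rw [hR, LinearMap.coe_range]
    exact (rbfIsometry hγ).isometry.isUniformInducing.isComplete_range
  have : CompleteSpace R := hcomp.completeSpace_coe
  suffices R = ⊤ from LinearMap.range_eq_top.mp this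
  rw [← Submodule.orthogonal_eq_bot_iff, Submodule.eq_bot_iff]
  intro f hf
  obtain ⟨C, hC, hK⟩ := rbfTransform_rbfKernel hγ
  refine RBFSpace.ext_fun fun w => ?_
  -- The transform of this ψ is a nonzero multiple of the reproducing kernel at w, so orthogonality
  -- to the range forces f w = 0.
  set ψ := (memLp_rbfKernel hγ (conj w)).toLp (rbfKernel γ (conj w))
  refine RBFSpace.apply_eq_zero_of_inner_eq_zero (rbfIsometry hγ ψ) f (w := w) hC (fun z => ?_)
    (hf _ ⟨ψ, rfl⟩)
  rw [rbfIsometry_apply, rbfTransform_congr_ae (memLp_rbfKernel hγ (conj w)).coeFn_toLp, hK]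

theorem rbfKernel_eq_mul_bargmannKernel {γ : ℝ} (hγ : 0 < γ) (z : ℂ) (x : ℝ) :
    rbfKernel γ z x = cexp (-z ^ 2 / (γ : ℂ) ^ 2) * bargmannKernel (2 / γ ^ 2) z x := by
  have hγ' : (γ : ℂ) ≠ 0 := by exact_mod_cast hγ.ne'
  have h2 : (Real.sqrt 2 : ℂ) ^ 2 = 2 := by
    rw [← Complex.ofReal_pow, Real.sq_sqrt (by norm_num)]; norm_num
  rw [rbfKernel_eq hγ, bargmannKernel, mul_left_comm, ← Complex.exp_add,
    show (2 / γ ^ 2 / Real.pi : ℝ) = 2 / (Real.pi * γ ^ 2) by field_simp]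
  congr 2
  push_cast
  field_simp
  linear_combination (-z ^ 2) * h2

theorem mainTheorem3 (γ : ℝ) (hγ : 0 < γ) :
    -- the series defining the kernel converges, and its sum in closed form
    (∀ (z : ℂ) (x : ℝ),
      HasSum (fun n : ℕ => rbfBasis γ n z * (hermiteFun (2 / γ ^ 2) n x : ℂ))
          (rbfKernel γ z x) ∧
        rbfKernel γ z x = (((2 / (Real.pi * γ ^ 2)) ^ (1 / 4 : ℝ) : ℝ) : ℂ) *
          Complex.exp (-((x : ℂ) - (Real.sqrt 2 : ℂ) * z) ^ 2 / (γ : ℂ) ^ 2)) ∧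
    -- the integral defining the transform converges absolutely, and is an inner product
    (∃ hΦ : ∀ z : ℂ, MemLp (rbfKernel γ z) 2 (volume : Measure ℝ),
      ∀ (ψ : Lp ℂ 2 (volume : Measure ℝ)) (z : ℂ),
        Integrable (fun x : ℝ => rbfKernel γ z x * ψ x) ∧
        rbfTransform γ ψ z = inner ℂ ((hΦ (conj z)).toLp (rbfKernel γ (conj z))) ψ) ∧
    -- the explicit integral formula
    (∀ (ψ : Lp ℂ 2 (volume : Measure ℝ)) (z : ℂ),
      rbfTransform γ ψ z = (((2 / (Real.pi * γ ^ 2)) ^ (1 / 4 : ℝ) : ℝ) : ℂ) *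
        ∫ x : ℝ, Complex.exp (-((x : ℂ) - (Real.sqrt 2 : ℂ) * z) ^ 2 / (γ : ℂ) ^ 2) * ψ x) ∧
    -- the transform is an isometric isomorphism of `L²(ℝ)` onto the RBF space
    (∃ U : Lp ℂ 2 (volume : Measure ℝ) ≃ₗᵢ[ℂ] RBFSpace γ hγ,
      ∀ (ψ : Lp ℂ 2 (volume : Measure ℝ)) (z : ℂ), U ψ z = rbfTransform γ ψ z) ∧
    -- it is a multiple of the classical Segal-Bargmann transform
    (∀ (ψ : Lp ℂ 2 (volume : Measure ℝ)) (z : ℂ),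
      rbfTransform γ ψ z =
        Complex.exp (-z ^ 2 / (γ : ℂ) ^ 2) * bargmannTransform (2 / γ ^ 2) ψ z) := by

  refine ⟨fun z x => ⟨hasSum_rbfKernel hγ z x, rbfKernel_eq hγ z x⟩,
    ⟨memLp_rbfKernel hγ, fun ψ z => ⟨integrable_rbfKernel_mul hγ z (Lp.memLp ψ), ?_⟩⟩,
    fun ψ z => ?_,
    ⟨LinearIsometryEquiv.ofSurjective (rbfIsometry hγ) (rbfIsometry_surjective hγ),
      fun ψ z => rfl⟩, fun ψ z => ?_⟩
  · rw [L2.inner_def, rbfTransform]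
    refine integral_congr_ae ?_
    filter_upwards [(memLp_rbfKernel hγ (conj z)).coeFn_toLp] with x hx
    rw [hx, RCLike.inner_apply, conj_rbfKernel hγ, Complex.conj_conj, mul_comm]
  · rw [rbfTransform, ← integral_const_mul]
    simp only [rbfKernel_eq hγ, mul_assoc]
  · rw [rbfTransform, bargmannTransform, ← integral_const_mul]
    simp only [rbfKernel_eq_mul_bargmannKernel hγ, mul_assoc]
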